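/- **Theorem 2.1.** Let $\gamma>0$ and $\beta\neq 0$ be real. Call $k>0$ admissible if either $\beta<0$, or $\beta>0$ and $k\neq\left(\frac{\gamma}{\beta n^2}\right)^{1/4}$ for every integer $n\ge 2$; let $K$ be the set of admissible $k$. There exist an open set $\Omega\subset\mathbb R\times K$ containing $\{0\}\times K$ and invariant under $(a,k)\mapsto(-a,k)$ (so that for each $k\in K$ it contains $(a,k)$ for all sufficiently small $|a|$), functions $w(a;k):\mathbb R\to\mathbb R$ and speeds $c(a;k)\in\mathbb R$ for $(a,k)\in\Omega$, such that: 1. For every $(a,k)\in\Omega$, $w=w(a;k)$ is $2\pi$-periodic, even and $C^\infty$, and with $c=c(a;k)$ it satisfies $$c k^2 w''+\beta k^4 w''''-k^2(w^2)''+\gamma w=0 ;$$ equivalently, $u(x,t)=w(a;k)\big(k(x-c(a;k)t)\big)$ is a traveling wave solution of the Ostrovsky equation $(u_t-\beta u_{xxx}+(u^2)_x)_x=\gamma u$. Moreover $c(-a;k)=c(a;k)$. 2. The family bifurcates from zero: $w(0;k)=0$ and $c(0;k)=c_0$ for $k\in K$, where $c_0=\frac{\gamma}{k^2}+\beta k^2$.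 3. $c$ is real-analytic in $(a,k)\in\Omega$, and $w$ depends real-analytically on $(a,k)\in\Omega$ in the sense that, for every $j\ge 0$, $(a,k)\mapsto\partial_z^j w(a;k)$ is a real-analytic map into the space of continuous $2\pi$-periodic functions with the supremum norm (equivalently, $w$ is real-analytic into $H^m(\mathbb R/2\pi\mathbb Z)$ for every $m$). 4. For each $k\in K$, as $a\to0$, $$w(a;k)(z)=a\cos z+a^2A_2\cos 2z+a^3A_3\cos 3z+a^4\left(A_{42}\cos 2z+A_{44}\cos 4z\right)+O(a^5),$$ uniformly in $z$ together with every $z$-derivative, and $$c(a;k)=c_0+a^2c_2+a^4c_4+O(a^6),$$ where $$A_2=\frac{2k^2}{3\gamma-12\beta k^4},\quad A_3=\frac{9k^2A_2}{8\gamma-72\beta k^4},\quad A_{42}=2A_2A_3-2A_2^3,\quad A_{44}=\frac{8k^2(A_2^2+2A_3)}{15\gamma-240\beta k^4},$$ $$c_2=A_2,\qquad c_4=3A_2A_3-2A_2^3 .$$ -/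

import Mathlib

open Real Filter Topology Asymptotics
open scoped ContDiff

/-- `u = u(x,t)` is a classical solution of the Ostrovsky equation
`(u_t - β u_xxx + (u²)_x)_x = γ u` on all of `ℝ × ℝ`. -/
def SolvesOstrovsky (β γ : ℝ) (u : ℝ → ℝ → ℝ) : Prop :=
  ContDiff ℝ 4 (fun p : ℝ × ℝ => u p.1 p.2) ∧
  ∀ x t : ℝ,
    deriv (fun y : ℝ =>
        deriv (fun s : ℝ => u y s) t
          - β * iteratedDeriv 3 (fun y' : ℝ => u y' t) y
          + deriv (fun y' : ℝ => u y' t ^ 2) y) x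
      = γ * u x t

/-- The profile equation `c k² w'' + β k⁴ w'''' - k² (w²)'' + γ w = 0`, pointwise on `ℝ`
(always used together with smoothness of `w`). -/
def SolvesProfile (β γ k c : ℝ) (w : ℝ → ℝ) : Prop :=
  ∀ z : ℝ,
    c * k ^ 2 * iteratedDeriv 2 w z + β * k ^ 4 * iteratedDeriv 4 w z
      - k ^ 2 * iteratedDeriv 2 (fun y : ℝ => w y ^ 2) z + γ * w z = 0

/-- The admissible wavenumbers: all `k > 0` if `β < 0`; all `k > 0` different from every resonant
value `(γ / (β n²))^(1/4)`, `n ≥ 2`, if `β > 0`. -/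
def admissibleWavenumbers (β γ : ℝ) : Set ℝ :=
  {k : ℝ | 0 < k ∧ (0 < β → ∀ n : ℕ, 2 ≤ n → k ≠ (γ / (β * (n : ℝ) ^ 2)) ^ (1 / 4 : ℝ))}

/-- The family `(a,k) ↦ w a k` of smooth `2π`-periodic functions depends real-analytically on
`(a,k) ∈ Ω`, as a map into function space: for every order `j`, the map `(a,k) ↦ ∂_z^j w(a;k)` is
real-analytic from `Ω` into the Banach space `C(ℝ/2πℤ)` with the sup norm. (Equivalently, by the
Sobolev embedding, `(a,k) ↦ w(a;k)` is real-analytic into `H^m(ℝ/2πℤ)` for every `m`.) -/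
def AnalyticProfileFamilyOn (w : ℝ → ℝ → ℝ → ℝ) (Ω : Set (ℝ × ℝ)) : Prop :=
  ∀ j : ℕ, ∃ D : ℝ × ℝ → C(AddCircle (2 * π), ℝ),
    (letI : Fact (0 < 2 * π) := ⟨Real.two_pi_pos⟩
     AnalyticOnNhd ℝ D Ω) ∧
    ∀ p ∈ Ω, ∀ z : ℝ, D p (z : AddCircle (2 * π)) = iteratedDeriv j (w p.1 p.2) z

noncomputable section

/-- Bifurcation speed `c₀`. -/
def speed0 (β γ k : ℝ) : ℝ := γ / k ^ 2 + β * k ^ 2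

def coeffA2 (β γ k : ℝ) : ℝ := 2 * k ^ 2 / (3 * γ - 12 * β * k ^ 4)

def coeffA3 (β γ k : ℝ) : ℝ := 9 * k ^ 2 * coeffA2 β γ k / (8 * γ - 72 * β * k ^ 4)

def coeffA42 (β γ k : ℝ) : ℝ := 2 * coeffA2 β γ k * coeffA3 β γ k - 2 * coeffA2 β γ k ^ 3

def coeffA44 (β γ k : ℝ) : ℝ :=
  8 * k ^ 2 * (coeffA2 β γ k ^ 2 + 2 * coeffA3 β γ k) / (15 * γ - 240 * β * k ^ 4)

def speed2 (β γ k : ℝ) : ℝ := coeffA2 β γ k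

def speed4 (β γ k : ℝ) : ℝ := 3 * coeffA2 β γ k * coeffA3 β γ k - 2 * coeffA2 β γ k ^ 3

/-- The fourth-order Stokes expansion of the profile. -/
def profileExpansion (β γ k a z : ℝ) : ℝ :=
  a * cos z + a ^ 2 * coeffA2 β γ k * cos (2 * z) + a ^ 3 * coeffA3 β γ k * cos (3 * z)
    + a ^ 4 * (coeffA42 β γ k * cos (2 * z) + coeffA44 β γ k * cos (4 * z))

/-- The expansion of the speed. -/
def speedExpansion (β γ k a : ℝ) : ℝ :=
  speed0 β γ k + a ^ 2 * speed2 β γ k + a ^ 4 * speed4 β γ k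

end

/-!
Write `w = a (cos z + v)`, where `v` has only the modes `cos (n z)` with `n ≠ 1`, and set
`Q = (cos z + v)²`, with first cosine coefficient `Q₁`. The profile equation in the mode `cos z`
gives the speed `c = c₀ + a Q₁`. In the modes `n ≥ 2` it becomes the fixed-point equation
`v = a m (Q₁ v - Q)` with the Fourier multiplier `mₙ = k² n² / ((n² - 1) (β k⁴ n² - γ))`, which is
bounded, and then analytic in `k`, as soon as no denominator vanishes.

We look for `v` among the cosine series with `∑ |vₙ| eⁿ < ∞`. They form a Banach algebra, and all
their derivatives are bounded uniformly, so that every `z`-derivative is controlled at once. The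
analytic implicit function theorem in the parameter `a m ∈ ℓ^∞` yields a unique small solution for
all nonresonant `k` simultaneously. By uniqueness, `z ↦ z + π` exchanges the solutions at `a` and
`-a`, so `c` is even in `a`. Finally, the truncated Stokes expansion solves the fixed-point equation
up to `O(a⁴)` and is therefore that close to `v`; this determines `c` up to `O(a⁵)`, hence up to
`O(a⁶)` because `c` is even.
-/

/-! ### Analytic functions and fixed points -/

section AnalyticOrder

variable {𝕜 E : Type*} [NontriviallyNormedField 𝕜] [NormedAddCommGroup E] [NormedSpace 𝕜 E]

lemma isBigO_sub_pow_iff_natCast_le_analyticOrderAt {f : 𝕜 → E} {z₀ : 𝕜} (hf : AnalyticAt 𝕜 f z₀)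
    {n : ℕ} : (f =O[𝓝 z₀] fun z => (z - z₀) ^ n) ↔ n ≤ analyticOrderAt f z₀ := by
  constructor
  · intro hO
    by_contra! hlt
    obtain ⟨m, hm⟩ := ENat.ne_top_iff_exists.1 hlt.ne_top
    obtain ⟨g, hg, hg0, hfg⟩ := hf.analyticOrderAt_eq_natCast.1 hm.symm
    have hmn : m < n := by rwa [← hm, Nat.cast_lt] at hlt
    have hg1 : (fun _ => (1 : 𝕜)) =O[𝓝 z₀] g :=
      (isBigO_const_const 1 hg0 _).trans
        ((isEquivalent_const_iff_tendsto hg0).2 hg.continuousAt.tendsto).isBigO_symm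
    have hpow : (fun z => (z - z₀) ^ m) =O[𝓝 z₀] f := by
      simpa using ((isBigO_refl (fun z => (z - z₀) ^ m) (𝓝 z₀)).smul hg1).trans_eventuallyEq
        (EventuallyEq.symm hfg)
    have hsub : Tendsto (fun z => z - z₀) (𝓝 z₀) (𝓝 0) := by
      simpa using (continuous_sub_right z₀).tendsto z₀
    refine isLittleO_irrefl ?_ ((hpow.trans hO).trans_isLittleO
      ((isLittleO_pow_pow hmn).comp_tendsto hsub))
    refine (eventually_mem_nhdsWithin.frequently.filter_mono (nhdsWithin_le_nhds (s := {z₀}ᶜ))).mono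
      fun z hz => pow_ne_zero m (sub_ne_zero.2 hz)
  · intro hn
    obtain ⟨g, hg, hfg⟩ := (natCast_le_analyticOrderAt hf).1 hn
    simpa using EventuallyEq.trans_isBigO hfg ((isBigO_refl (fun z => (z - z₀) ^ n) (𝓝 z₀)).smul
      (hg.continuousAt.tendsto.isBigO_one 𝕜))

end AnalyticOrder

lemma iteratedDeriv_zero_eq_zero_of_even {E : Type*} [NormedAddCommGroup E] [NormedSpace ℝ E]
    {f : ℝ → E} (hf : ∀ᶠ a in 𝓝 0, f (-a) = f a) {n : ℕ} (hn : Odd n) :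
    iteratedDeriv n f 0 = 0 := by
  have h : iteratedDeriv n f 0 = -iteratedDeriv n f 0 := by
    simpa [hn.neg_one_pow, EventuallyEq.iteratedDeriv_eq n hf] using iteratedDeriv_comp_neg n f 0
  have : IsAddTorsionFree E := .of_isTorsionFree ℝ E
  exact self_eq_neg.1 h

lemma isBigO_pow_succ_of_even {E : Type*} [NormedAddCommGroup E] [NormedSpace ℝ E]
    [CompleteSpace E] {f : ℝ → E} (hf : AnalyticAt ℝ f 0) (heven : ∀ᶠ a in 𝓝 0, f (-a) = f a)
    {n : ℕ} (hn : Odd n) (hO : f =O[𝓝 0] fun a => a ^ n) :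
    f =O[𝓝 0] fun a => a ^ (n + 1) := by
  have horder (m : ℕ) : (f =O[𝓝 0] fun a => a ^ m) ↔ ∀ i < m, iteratedDeriv i f 0 = 0 := by
    rw [← natCast_le_analyticOrderAt_iff_iteratedDeriv_eq_zero hf,
      ← isBigO_sub_pow_iff_natCast_le_analyticOrderAt hf]
    simp only [sub_zero]
  rw [horder] at hO ⊢
  intro i hi
  obtain hi | rfl := (Nat.lt_succ_iff.1 hi).lt_or_eq
  · exact hO i hi
  · exact iteratedDeriv_zero_eq_zero_of_even heven hn

section FixedPoint

variable {𝕜 E F G : Type*} [RCLike 𝕜] [NormedAddCommGroup E] [NormedSpace 𝕜 E] [CompleteSpace E]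
  [NormedAddCommGroup F] [NormedSpace 𝕜 F] [CompleteSpace F]
  [NormedAddCommGroup G] [NormedSpace 𝕜 G]

lemma exists_analyticAt_fixedPoint (B : G →L[𝕜] F →L[𝕜] E) {N : E → G}
    (hN : ContDiffAt 𝕜 ω N 0) :
    ∃ Φ : F → E, Φ 0 = 0 ∧ AnalyticAt 𝕜 Φ 0 ∧
      ∀ᶠ p in 𝓝 (0 : F × E), p.2 = B (N p.2) p.1 ↔ Φ p.1 = p.2 := by
  let defect (p : F × E) : E := p.2 - B (N p.2) p.1
  have hdefect : ContDiffAt 𝕜 ω defect 0 :=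
    contDiffAt_snd.sub (((B.contDiff.contDiffAt.comp _ hN).comp (0 : F × E)
      contDiffAt_snd).clm_apply contDiffAt_fst)
  have hpartial : fderiv 𝕜 defect 0 ∘L .inr 𝕜 F E = .id 𝕜 E := by
    have h := (hdefect.differentiableAt (by simp)).hasFDerivAt.comp (0 : E)
      (ContinuousLinearMap.inr 𝕜 F E).hasFDerivAt
    refine h.unique ((hasFDerivAt_id (𝕜 := 𝕜) (0 : E)).congr_of_eventuallyEq (.of_forall ?_))
    simp [defect]
  have hinv : (fderiv 𝕜 defect 0 ∘L .inr 𝕜 F E).IsInvertible := hpartial ▸ ⟨.refl 𝕜 _, rfl⟩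
  have hω : (ω : WithTop ℕ∞) ≠ 0 := by simp
  refine ⟨hdefect.implicitFunction hω hinv, hdefect.implicitFunction_apply_self hω hinv,
    (hdefect.contDiffAt_implicitFunction hω hinv).analyticAt, ?_⟩
  filter_upwards [hdefect.eventually_apply_eq_iff_implicitFunction hω hinv] with p hp
  rw [← hp]
  simp [defect, sub_eq_zero]

end FixedPoint

lemma isUnit_of_tendsto_ne_zero {f : BoundedContinuousFunction ℕ ℝ} {l : ℝ}
    (hf : ∀ n, f n ≠ 0) (hl : Tendsto f atTop (𝓝 l)) (hl0 : l ≠ 0) : IsUnit f := by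
  obtain ⟨C, hC⟩ := (Metric.isBounded_range_of_tendsto _ (hl.inv₀ hl0)).exists_norm_le
  refine IsUnit.of_mul_eq_one (BoundedContinuousFunction.ofNormedAddCommGroupDiscrete
    (fun n => (f n)⁻¹) C fun n => hC _ ⟨n, rfl⟩) ?_
  ext n
  exact mul_inv_cancel₀ (hf n)

/-! ### Travelling waves of the Ostrovsky equation -/

lemma hasDerivAt_iteratedDeriv_comp {𝕜 F : Type*} [NontriviallyNormedField 𝕜]
    [NormedAddCommGroup F] [NormedSpace 𝕜 F] {f : 𝕜 → F} {n : ℕ} (hf : ContDiff 𝕜 (n + 1) f)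
    {g : 𝕜 → 𝕜} {g' x : 𝕜} (hg : HasDerivAt g g' x) :
    HasDerivAt (fun y => iteratedDeriv n f (g y)) (g' • iteratedDeriv (n + 1) f (g x)) x := by
  have h : HasDerivAt (iteratedDeriv n f) (iteratedDeriv (n + 1) f (g x)) (g x) := by
    rw [iteratedDeriv_succ]
    exact (hf.differentiable_iteratedDeriv n (by exact_mod_cast n.lt_succ_self) _).hasDerivAt
  exact h.scomp x hg

lemma iteratedDeriv_comp_mul_sub {𝕜 F : Type*} [NontriviallyNormedField 𝕜]
    [NormedAddCommGroup F] [NormedSpace 𝕜 F] {f : 𝕜 → F} {n : ℕ} (hf : ContDiff 𝕜 n f) (k s : 𝕜) :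
    iteratedDeriv n (fun y => f (k * (y - s))) =
      fun y => k ^ n • iteratedDeriv n f (k * (y - s)) := by
  rw [iteratedDeriv_comp_sub_const n (fun y => f (k * y)) s]
  funext y
  exact congrFun (iteratedDeriv_comp_const_smul hf k) (y - s)

lemma SolvesProfile.solvesOstrovsky {β γ k c : ℝ} {w : ℝ → ℝ} (hw : ContDiff ℝ 4 w)
    (h : SolvesProfile β γ k c w) : SolvesOstrovsky β γ (fun x t => w (k * (x - c * t))) := by
  refine ⟨hw.comp (by fun_prop), fun x t => ?_⟩
  have hwn (n : ℕ) (hn : n ≤ 4 := by norm_num) : ContDiff ℝ n w := hw.of_le (by exact_mod_cast hn)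
  have hw2 : ContDiff ℝ 2 fun z => w z ^ 2 := (hwn 2).pow 2
  have hphase_t (y : ℝ) : HasDerivAt (fun s => k * (y - c * s)) (-(k * c)) t := by
    simpa using (((hasDerivAt_id t).const_mul c).const_sub y).const_mul k
  have hphase_x : HasDerivAt (fun y => k * (y - c * t)) k x := by
    simpa using ((hasDerivAt_id x).sub_const (c * t)).const_mul k
  have hut (y : ℝ) : deriv (fun s => w (k * (y - c * s))) t =
      -(k * c) * iteratedDeriv 1 w (k * (y - c * t)) := by
    have := (hasDerivAt_iteratedDeriv_comp (n := 0) (by simpa using hwn 1) (hphase_t y)).deriv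
    simpa only [iteratedDeriv_zero, smul_eq_mul] using this
  have huxxx := iteratedDeriv_comp_mul_sub (hwn 3) k (c * t)
  have husq (y : ℝ) : deriv (fun y => w (k * (y - c * t)) ^ 2) y =
      k * iteratedDeriv 1 (fun z => w z ^ 2) (k * (y - c * t)) := by
    have := congrFun (iteratedDeriv_comp_mul_sub (n := 1) (hw2.of_le (by norm_num)) k (c * t)) y
    simpa only [iteratedDeriv_one, pow_one, smul_eq_mul] using this
  simp only [hut, huxxx, husq]
  have hderiv := (((hasDerivAt_iteratedDeriv_comp (n := 1) (hwn 2) hphase_x).const_mul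
    (-(k * c))).sub (((hasDerivAt_iteratedDeriv_comp (n := 3) (hwn 4) hphase_x).const_smul
    (k ^ 3)).const_mul β)).add ((hasDerivAt_iteratedDeriv_comp (n := 1) hw2 hphase_x).const_mul k)
  refine hderiv.deriv.trans ?_
  simp only [smul_eq_mul]
  linear_combination -h (k * (x - c * t))

/-! ### Cosine series with exponentially decaying coefficients -/

lemma neg_one_pow_natAbs_sub {R : Type*} [Ring R] (n m : ℕ) :
    (-1 : R) ^ ((n : ℤ) - m).natAbs = (-1) ^ n * (-1) ^ m := by
  rw [← pow_add]
  exact neg_one_pow_congr (by grind)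

noncomputable section

/-- The Banach space of cosine series `∑ cₙ cos (n z)` with `∑ |cₙ| eⁿ < ∞`. Such a series is
encoded by the absolutely summable sequence `n ↦ cₙ eⁿ`, so `cₙ` is read off with `coeff`. -/
abbrev CosineSpace : Type := lp (fun _ : ℕ => ℝ) 1

/-- Bounded sequences, acting on `CosineSpace` as Fourier multipliers. -/
abbrev Multiplier : Type := BoundedContinuousFunction ℕ ℝ

namespace CosineSpace

/-- The cosine series `cos (n z)`. -/
def mode (n : ℕ) : CosineSpace := lp.single 1 n (exp n)

/-- The coefficient of `cos (n z)`. -/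
def coeff (n : ℕ) : CosineSpace →L[ℝ] ℝ := exp (-n) • lp.evalCLM ℝ (fun _ : ℕ => ℝ) 1 n

lemma coeff_apply (n : ℕ) (x : CosineSpace) : coeff n x = exp (-n) * x n := rfl

lemma coeff_mode (n m : ℕ) : coeff n (mode m) = if n = m then 1 else 0 := by
  rw [coeff_apply, mode]
  split_ifs with h
  · simp [h, ← exp_add]
  · simp [lp.single_apply, h]

lemma abs_coeff_mul_exp (n : ℕ) (x : CosineSpace) : |coeff n x| * exp n = |x n| := by
  rw [coeff_apply, abs_mul, abs_exp, mul_right_comm, ← exp_add]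
  simp

lemma norm_eq_tsum (x : CosineSpace) : ‖x‖ = ∑' n, |coeff n x| * exp n := by
  simp [lp.norm_eq_tsum_rpow (p := 1) (by norm_num) x, abs_coeff_mul_exp]

lemma summable_abs_coeff_mul_exp (x : CosineSpace) : Summable fun n => |coeff n x| * exp n := by
  simpa [abs_coeff_mul_exp] using (lp.memℓp x).summable (by norm_num)

lemma norm_mode (n : ℕ) : ‖mode n‖ = exp n := by
  rw [mode, lp.norm_single (by norm_num), norm_eq_abs, abs_exp]

section Lift

variable {E : Type*} [NormedAddCommGroup E] [NormedSpace ℝ E]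

@[ext] lemma ext_mode {f g : CosineSpace →L[ℝ] E} (h : ∀ n, f (mode n) = g (mode n)) : f = g := by
  refine lp.ext_continuousLinearMap (by norm_num) fun n => ?_
  ext
  have hsingle : lp.single 1 n (1 : ℝ) = exp (-n) • mode n := by
    rw [mode, ← lp.single_smul, smul_eq_mul, ← exp_add, neg_add_cancel, exp_zero]
  simp [hsingle, h n]

lemma norm_coeff_smul_le {u : ℕ → E} {C : ℝ} (hu : ∀ n, ‖u n‖ ≤ C * exp n) (x : CosineSpace)
    (n : ℕ) : ‖coeff n x • u n‖ ≤ |coeff n x| * exp n * C := by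
  rw [norm_smul, norm_eq_abs, mul_assoc, mul_comm (exp _)]
  gcongr
  exact hu n

variable [CompleteSpace E]

lemma summable_coeff_smul {u : ℕ → E} {C : ℝ} (hu : ∀ n, ‖u n‖ ≤ C * exp n) (x : CosineSpace) :
    Summable fun n => coeff n x • u n :=
  .of_norm_bounded ((summable_abs_coeff_mul_exp x).mul_right C) (norm_coeff_smul_le hu x)

/-- The continuous linear map sending `cos (n z)` to `u n`. -/
def lift (u : ℕ → E) (C : ℝ) (hu : ∀ n, ‖u n‖ ≤ C * exp n) : CosineSpace →L[ℝ] E :=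
  LinearMap.mkContinuous
    { toFun := fun x => ∑' n, coeff n x • u n
      map_add' := fun x y => by
        rw [← (summable_coeff_smul hu x).tsum_add (summable_coeff_smul hu y)]
        simp only [map_add, add_smul]
      map_smul' := fun r x => by
        rw [RingHom.id_apply, ← (summable_coeff_smul hu x).tsum_const_smul]
        simp only [map_smul, smul_assoc] } C
    (fun x => by
      rw [norm_eq_tsum, mul_comm, ← tsum_mul_right]
      exact tsum_of_norm_bounded ((summable_abs_coeff_mul_exp x).mul_right C).hasSum
        (norm_coeff_smul_le hu x))

variable {u : ℕ → E} {C : ℝ} (hu : ∀ n, ‖u n‖ ≤ C * exp n)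

lemma hasSum_lift (x : CosineSpace) : HasSum (fun n => coeff n x • u n) (lift u C hu x) :=
  (summable_coeff_smul hu x).hasSum

@[simp] lemma lift_mode (n : ℕ) : lift u C hu (mode n) = u n := by
  refine (hasSum_lift hu (mode n)).unique ?_
  convert! hasSum_ite_eq n (u n) using 2 with m
  split_ifs with h <;> simp [coeff_mode, h]

lemma norm_lift_le (hC : 0 ≤ C) : ‖lift u C hu‖ ≤ C :=
  LinearMap.mkContinuous_norm_le _ hC _

end Lift

/-! ### Products, multipliers and the half-period shift -/

lemma norm_half_add_mode_le (n m : ℕ) :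
    ‖(1 / 2 : ℝ) • (mode (n + m) + mode ((n : ℤ) - m).natAbs)‖ ≤ exp n * exp m := by
  have hsub : exp (((n : ℤ) - m).natAbs : ℕ) ≤ exp n * exp m := by
    rw [← exp_add, exp_le_exp]
    exact_mod_cast (show ((n : ℤ) - m).natAbs ≤ n + m by omega)
  have hadd := norm_add_le (mode (n + m)) (mode ((n : ℤ) - m).natAbs)
  rw [norm_mode, norm_mode, Nat.cast_add, exp_add] at hadd
  rw [norm_smul, norm_eq_abs, abs_of_pos (by norm_num)]
  linarith

/-- The pointwise product of cosine series, from
`cos (n z) cos (m z) = (cos ((n + m) z) + cos (|n - m| z)) / 2`. -/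
def prod : CosineSpace →L[ℝ] CosineSpace →L[ℝ] CosineSpace :=
  lift (fun n => lift (fun m => (1 / 2 : ℝ) • (mode (n + m) + mode ((n : ℤ) - m).natAbs)) (exp n)
    (norm_half_add_mode_le n)) 1 (fun n => by
      rw [one_mul]
      exact norm_lift_le _ (exp_pos _).le)

@[simp] lemma prod_mode (n m : ℕ) :
    prod (mode n) (mode m) = (1 / 2 : ℝ) • (mode (n + m) + mode ((n : ℤ) - m).natAbs) := by
  simp [prod]

/-- The action of multipliers: `diag x μ` has the coefficients `μ n * coeff n x`. -/
def diag : CosineSpace →L[ℝ] Multiplier →L[ℝ] CosineSpace :=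
  lift (E := Multiplier →L[ℝ] CosineSpace)
    (fun n => (BoundedContinuousFunction.evalCLM ℝ n).smulRight (mode n)) 1
    (fun n => by
      rw [ContinuousLinearMap.norm_smulRight_apply, norm_mode]
      gcongr
      exact ContinuousLinearMap.opNorm_le_bound _ zero_le_one fun μ => by
        simpa using μ.norm_coe_le_norm n)

@[simp] lemma diag_mode (n : ℕ) (μ : Multiplier) : diag (mode n) μ = μ n • mode n := by
  simp [diag]

lemma coeff_diag (n : ℕ) (x : CosineSpace) (μ : Multiplier) :
    coeff n (diag x μ) = μ n * coeff n x := by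
  have h : coeff n ∘L diag.flip μ = μ n • coeff n := by
    ext m
    by_cases h : n = m <;> simp [coeff_mode, h]
  exact DFunLike.congr_fun h x

/-- The translation `z ↦ z + π`. -/
def shift : CosineSpace →L[ℝ] CosineSpace :=
  lift (fun n => (-1 : ℝ) ^ n • mode n) 1 (fun n => by simp [norm_smul, norm_mode])

@[simp] lemma shift_mode (n : ℕ) : shift (mode n) = (-1 : ℝ) ^ n • mode n := by simp [shift]

lemma coeff_shift (n : ℕ) (x : CosineSpace) : coeff n (shift x) = (-1) ^ n * coeff n x := by
  have h : coeff n ∘L shift = (-1 : ℝ) ^ n • coeff n := by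
    ext m
    by_cases h : n = m <;> simp [coeff_mode, h]
  exact DFunLike.congr_fun h x

lemma diag_shift (x : CosineSpace) (μ : Multiplier) : diag (shift x) μ = shift (diag x μ) := by
  have h : diag.flip μ ∘L shift = shift ∘L diag.flip μ := by
    ext n : 1
    simp [smul_smul, mul_comm]
  exact DFunLike.congr_fun h x

lemma prod_shift (x y : CosineSpace) : prod (shift x) (shift y) = shift (prod x y) := by
  have h : (prod ∘L shift).bilinearComp (.id ℝ _) shift =
      (ContinuousLinearMap.compL ℝ _ _ _ shift) ∘L prod := by
    ext n : 1
    ext m : 1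
    simp only [ContinuousLinearMap.bilinearComp_apply, ContinuousLinearMap.id_apply,
      ContinuousLinearMap.comp_apply, ContinuousLinearMap.compL_apply, shift_mode, prod_mode,
      map_add, map_smul, smul_apply, smul_add, smul_smul, pow_add, neg_one_pow_natAbs_sub]
    module
  exact DFunLike.congr_fun (DFunLike.congr_fun h x) y

end CosineSpace

end

/-! ### Evaluation of cosine series and their derivatives -/

noncomputable section

namespace CosineSpace

local instance fact_zero_lt_two_pi : Fact (0 < 2 * π) := ⟨two_pi_pos⟩

lemma periodic_cos_natCast_mul_add (n : ℕ) (θ : ℝ) :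
    Function.Periodic (fun z : ℝ => cos (n * z + θ)) (2 * π) := fun z => by
  simp only
  rw [← cos_add_nat_mul_two_pi (n * z + θ) n]
  ring_nf

/-- The `j`-th derivative `n ^ j * cos (n z + j π / 2)` of `cos (n z)`, as a function on the
circle. -/
def circleMode (j n : ℕ) : C(AddCircle (2 * π), ℝ) where
  toFun x := n ^ j * (periodic_cos_natCast_mul_add n (j * (π / 2))).lift x
  continuous_toFun := by
    refine continuous_const.mul (continuous_coinduced_dom.2 ?_)
    change Continuous fun z : ℝ => cos (n * z + j * (π / 2))
    fun_prop

lemma circleMode_coe (j n : ℕ) (z : ℝ) :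
    circleMode j n (z : AddCircle (2 * π)) = n ^ j * cos (n * z + j * (π / 2)) := rfl

lemma abs_natCast_pow_mul_cos_le (j n : ℕ) (θ : ℝ) :
    |(n : ℝ) ^ j * cos θ| ≤ j.factorial * exp n := by
  have hexp : (n : ℝ) ^ j ≤ j.factorial * exp n := by
    have := pow_div_factorial_le_exp (n : ℝ) n.cast_nonneg j
    rwa [div_le_iff₀' (by positivity)] at this
  rw [abs_mul, abs_of_nonneg (by positivity)]
  exact (mul_le_of_le_one_right (by positivity) (abs_cos_le_one _)).trans hexp

/-- The `j`-th derivative of a cosine series, as a continuous function on the circle. -/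
def toCircleMap (j : ℕ) : CosineSpace →L[ℝ] C(AddCircle (2 * π), ℝ) :=
  lift (circleMode j) j.factorial (fun n => by
    refine (ContinuousMap.norm_le _ (by positivity)).2 fun x => ?_
    induction x using QuotientAddGroup.induction_on with
    | H z => exact abs_natCast_pow_mul_cos_le j n _)

/-- The `j`-th derivative of a cosine series at `z`. -/
def evalDeriv (j : ℕ) (z : ℝ) : CosineSpace →L[ℝ] ℝ :=
  ContinuousMap.evalCLM ℝ (z : AddCircle (2 * π)) ∘L toCircleMap j

lemma evalDeriv_eq_toCircleMap (j : ℕ) (z : ℝ) (x : CosineSpace) :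
    evalDeriv j z x = toCircleMap j x (z : AddCircle (2 * π)) := rfl

@[simp] lemma evalDeriv_mode (j : ℕ) (z : ℝ) (n : ℕ) :
    evalDeriv j z (mode n) = n ^ j * cos (n * z + j * (π / 2)) := by
  rw [evalDeriv_eq_toCircleMap, toCircleMap, lift_mode, circleMode_coe]

lemma hasSum_evalDeriv (j : ℕ) (z : ℝ) (x : CosineSpace) :
    HasSum (fun n => coeff n x * (n ^ j * cos (n * z + j * (π / 2)))) (evalDeriv j z x) := by
  have h : evalDeriv j z = lift (fun n => (n : ℝ) ^ j * cos (n * z + j * (π / 2))) j.factorial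
      (fun n => abs_natCast_pow_mul_cos_le j n _) := by
    ext n; simp
  rw [h]
  exact hasSum_lift _ x

lemma hasDerivAt_natCast_pow_mul_cos (j n : ℕ) (z : ℝ) :
    HasDerivAt (fun z => (n : ℝ) ^ j * cos (n * z + j * (π / 2)))
      (n ^ (j + 1) * cos (n * z + (j + 1 : ℕ) * (π / 2))) z := by
  have hphase : HasDerivAt (fun z : ℝ => n * z + j * (π / 2)) (n : ℝ) z := by
    simpa using ((hasDerivAt_id z).const_mul (n : ℝ)).add_const (j * (π / 2))
  convert! hphase.cos.const_mul ((n : ℝ) ^ j) using 1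
  rw [show (n : ℝ) * z + (j + 1 : ℕ) * (π / 2) = n * z + j * (π / 2) + π / 2 by push_cast; ring,
    cos_add_pi_div_two]
  ring

lemma hasDerivAt_evalDeriv (j : ℕ) (x : CosineSpace) (z : ℝ) :
    HasDerivAt (fun z => evalDeriv j z x) (evalDeriv (j + 1) z x) z := by
  have h := hasDerivAt_tsum (𝕜 := ℝ)
    ((summable_abs_coeff_mul_exp x).mul_right ((j + 1).factorial : ℝ))
    (fun n y => (hasDerivAt_natCast_pow_mul_cos j n y).const_mul (coeff n x))
    (fun n y => norm_coeff_smul_le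
      (u := fun n => (n : ℝ) ^ (j + 1) * cos (n * y + (j + 1 : ℕ) * (π / 2)))
      (fun n => abs_natCast_pow_mul_cos_le (j + 1) n _) x n)
    (hasSum_evalDeriv j z x).summable z
  simpa only [(hasSum_evalDeriv _ _ x).tsum_eq] using h

lemma iteratedDeriv_evalDeriv (x : CosineSpace) (j : ℕ) :
    iteratedDeriv j (fun z => evalDeriv 0 z x) = fun z => evalDeriv j z x := by
  induction j with
  | zero => exact iteratedDeriv_zero
  | succ j ih =>
    rw [iteratedDeriv_succ, ih]
    exact funext fun z => (hasDerivAt_evalDeriv j x z).deriv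

lemma contDiff_evalDeriv (x : CosineSpace) : ContDiff ℝ ∞ fun z => evalDeriv 0 z x := by
  refine contDiff_of_differentiable_iteratedDeriv fun j _ => ?_
  rw [iteratedDeriv_evalDeriv]
  exact fun z => (hasDerivAt_evalDeriv j x z).differentiableAt

lemma abs_evalDeriv_le (j : ℕ) (z : ℝ) (x : CosineSpace) :
    |evalDeriv j z x| ≤ j.factorial * ‖x‖ :=
  ((toCircleMap j x).norm_coe_le_norm _).trans
    ((toCircleMap j).le_of_opNorm_le (norm_lift_le _ (by positivity)) x)

lemma periodic_evalDeriv (j : ℕ) (x : CosineSpace) :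
    Function.Periodic (fun z => evalDeriv j z x) (2 * π) := fun z => by
  simp only [evalDeriv_eq_toCircleMap, AddCircle.coe_add_period]

lemma even_evalDeriv_zero (x : CosineSpace) : Function.Even fun z => evalDeriv 0 z x := fun z => by
  have h : evalDeriv 0 (-z) = evalDeriv 0 z := by
    ext n; simp
  exact DFunLike.congr_fun h x

lemma cos_natAbs_sub_mul (n m : ℕ) (z : ℝ) :
    cos ((((n : ℤ) - m).natAbs : ℕ) * z) = cos (n * z - m * z) := by
  rw [← sub_mul, Nat.cast_natAbs]
  push_cast
  rcases abs_cases ((n : ℝ) - m) with h | h <;> rw [h.1]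
  rw [neg_mul, cos_neg]

lemma evalDeriv_zero_prod (z : ℝ) (x y : CosineSpace) :
    evalDeriv 0 z (prod x y) = evalDeriv 0 z x * evalDeriv 0 z y := by
  have h : (ContinuousLinearMap.compL ℝ _ _ _ (evalDeriv 0 z)) ∘L prod =
      (ContinuousLinearMap.mul ℝ ℝ).bilinearComp (evalDeriv 0 z) (evalDeriv 0 z) := by
    ext n : 1
    ext m : 1
    simp only [ContinuousLinearMap.comp_apply, ContinuousLinearMap.compL_apply, prod_mode,
      map_smul, map_add, evalDeriv_mode, ContinuousLinearMap.bilinearComp_apply,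
      ContinuousLinearMap.mul_apply', pow_zero, Nat.cast_zero, zero_mul, add_zero, one_mul,
      smul_eq_mul, cos_natAbs_sub_mul]
    rw [Nat.cast_add, add_mul, cos_add, cos_sub]
    ring
  exact DFunLike.congr_fun (DFunLike.congr_fun h x) y

lemma exists_analyticOnNhd_circle_iteratedDeriv_eq {F : Type*} [NormedAddCommGroup F]
    [NormedSpace ℝ F] {x : F → CosineSpace} {s : Set F} (hx : AnalyticOnNhd ℝ x s) (j : ℕ) :
    ∃ D : F → C(AddCircle (2 * π), ℝ), AnalyticOnNhd ℝ D s ∧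
      ∀ p (z : ℝ), D p z = iteratedDeriv j (fun y => evalDeriv 0 y (x p)) z :=
  ⟨fun p => toCircleMap j (x p), fun p hp => ((toCircleMap j).analyticAt _).comp (hx p hp),
    fun p _ => by rw [iteratedDeriv_evalDeriv (x p)]; rfl⟩

end CosineSpace

end

/-! ### The multiplier of the linearised equation -/

/-- The wavenumbers at which no mode `cos (n z)`, `n ≥ 2`, solves the linearised profile equation at
the speed `c₀`. -/
def nonresonantWavenumbers (β γ : ℝ) : Set ℝ :=
  {k | 0 < k ∧ ∀ n : ℕ, 2 ≤ n → β * k ^ 4 * n ^ 2 ≠ γ}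

lemma eq_rpow_iff_mul_sq_eq {β γ k : ℝ} (hγ : 0 ≤ γ) (hβ : 0 < β) (hk : 0 ≤ k) {n : ℕ}
    (hn : n ≠ 0) :
    k = (γ / (β * (n : ℝ) ^ 2)) ^ (1 / 4 : ℝ) ↔ β * k ^ 4 * n ^ 2 = γ := by
  rw [one_div (4 : ℝ), eq_rpow_inv hk (by positivity) (by norm_num),
    show (4 : ℝ) = (4 : ℕ) by norm_num, rpow_natCast, eq_div_iff (by positivity), mul_left_comm,
    mul_assoc]

lemma admissibleWavenumbers_eq_nonresonantWavenumbers {β γ : ℝ} (hγ : 0 < γ) :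
    admissibleWavenumbers β γ = nonresonantWavenumbers β γ := by
  ext k
  refine and_congr_right fun hk => ⟨fun h n hn => ?_, fun h hβ n hn => ?_⟩
  · rcases lt_or_ge 0 β with hβ | hβ
    · exact (eq_rpow_iff_mul_sq_eq hγ.le hβ hk.le (by omega)).not.1 (h hβ n hn)
    · have : β * (k ^ 4 * n ^ 2) ≤ 0 := mul_nonpos_of_nonpos_of_nonneg hβ (by positivity)
      linarith
  · exact (eq_rpow_iff_mul_sq_eq hγ.le hβ hk.le (by omega)).not.2 (h n hn)

noncomputable section

/-- The leading part of `resonanceMultiplier`. -/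
def resonanceLeading (β : ℝ) : Multiplier :=
  BoundedContinuousFunction.ofNormedAddCommGroupDiscrete
    (fun n => β * (max n 2 : ℕ) ^ 2 / (|β| * (max n 2 : ℕ) ^ 2 + 1)) 1 fun n => by
      rw [norm_div, norm_mul, norm_eq_abs β, norm_of_nonneg (by positivity),
        norm_of_nonneg (by positivity), div_le_one (by positivity)]
      linarith

/-- The part of `resonanceMultiplier` of lower order. -/
def resonanceRemainder (β : ℝ) : Multiplier :=
  BoundedContinuousFunction.ofNormedAddCommGroupDiscrete
    (fun n => 1 / (|β| * (max n 2 : ℕ) ^ 2 + 1)) 1 fun n => by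
      rw [norm_of_nonneg (by positivity), div_le_one (by positivity)]
      exact le_add_of_nonneg_left (by positivity)

/-- The multiplier `(β k ^ 4 n ^ 2 - γ) / (|β| n ^ 2 + 1)` for `n ≥ 2`. The denominator keeps it
bounded, and bounded away from zero in the absence of resonances even if `β = 0`; `n = 0` and
`n = 1` play no role and are given the value at `n = 2`. -/
def resonanceMultiplier (β γ k : ℝ) : Multiplier :=
  k ^ 4 • resonanceLeading β - γ • resonanceRemainder β

/-- The factor by which `stokesMultiplier` differs from `k ^ 2` times the inverse of
`resonanceMultiplier`. -/
def stokesWeight (β : ℝ) : Multiplier :=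
  BoundedContinuousFunction.ofNormedAddCommGroupDiscrete
    (fun n => if 2 ≤ n then (n : ℝ) ^ 2 / ((n ^ 2 - 1) * (|β| * n ^ 2 + 1)) else 0) 2 fun n => by
      split_ifs with h
      · have hn : (2 : ℝ) ≤ n := by exact_mod_cast h
        have hn2 : (4 : ℝ) ≤ n ^ 2 := by nlinarith
        have hpos : 0 < (n : ℝ) ^ 2 - 1 := by linarith
        rw [norm_of_nonneg (by positivity), div_le_iff₀ (by positivity)]
        nlinarith [mul_nonneg (abs_nonneg β) (sq_nonneg (n : ℝ))]
      · simp

/-- The multiplier `k ^ 2 n ^ 2 / ((n ^ 2 - 1) (β k ^ 4 n ^ 2 - γ))` for `n ≥ 2`, and zero for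
`n < 2`, which inverts the linearised profile equation away from its kernel. Its values are
meaningful only at nonresonant wavenumbers. -/
def stokesMultiplier (β γ k : ℝ) : Multiplier :=
  k ^ 2 • (stokesWeight β * Ring.inverse (resonanceMultiplier β γ k))

lemma resonanceMultiplier_apply (β γ k : ℝ) (n : ℕ) :
    resonanceMultiplier β γ k n =
      (β * k ^ 4 * (max n 2 : ℕ) ^ 2 - γ) / (|β| * (max n 2 : ℕ) ^ 2 + 1) := by
  change k ^ 4 * (_ / _) - γ * (1 / _) = _
  ring

lemma resonanceMultiplier_ne_zero_iff {β γ k : ℝ} (n : ℕ) :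
    resonanceMultiplier β γ k n ≠ 0 ↔ β * k ^ 4 * (max n 2 : ℕ) ^ 2 ≠ γ := by
  rw [resonanceMultiplier_apply, div_ne_zero_iff, sub_ne_zero, and_iff_left (by positivity)]

lemma tendsto_resonanceMultiplier {β : ℝ} (hβ : β ≠ 0) (γ k : ℝ) :
    Tendsto (resonanceMultiplier β γ k) atTop (𝓝 (β * k ^ 4 / |β|)) := by
  have hinv : Tendsto (fun n : ℕ => ((max n 2 : ℕ) ^ 2 : ℝ)⁻¹) atTop (𝓝 0) := by
    refine tendsto_inv_atTop_zero.comp ((tendsto_pow_atTop two_ne_zero).comp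
      (tendsto_natCast_atTop_atTop.comp (tendsto_atTop_mono (le_max_left · 2) tendsto_id)))
  have hquot := ((tendsto_const_nhds (x := β * k ^ 4)).sub (hinv.const_mul γ)).div
    ((tendsto_const_nhds (x := |β|)).add hinv) (by simpa using hβ)
  rw [mul_zero, sub_zero, add_zero] at hquot
  refine hquot.congr fun n => ?_
  have hn : ((max n 2 : ℕ) : ℝ) ≠ 0 := by positivity
  rw [Pi.div_apply, resonanceMultiplier_apply]
  field_simp

lemma exists_tendsto_resonanceMultiplier_ne_zero {β γ k : ℝ}
    (hk : k ∈ nonresonantWavenumbers β γ) :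
    ∃ l ≠ 0, Tendsto (resonanceMultiplier β γ k) atTop (𝓝 l) := by
  rcases eq_or_ne β 0 with rfl | hβ
  · have hγ : γ ≠ 0 := by simpa [eq_comm] using hk.2 2 le_rfl
    refine ⟨-γ, neg_ne_zero.2 hγ, tendsto_const_nhds.congr fun n => ?_⟩
    simp [resonanceMultiplier_apply]
  · have := hk.1
    exact ⟨_, by positivity, tendsto_resonanceMultiplier hβ γ k⟩

lemma mem_nonresonantWavenumbers_iff {β γ k : ℝ} :
    k ∈ nonresonantWavenumbers β γ ↔ 0 < k ∧ IsUnit (resonanceMultiplier β γ k) := by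
  refine ⟨fun hk => ⟨hk.1, ?_⟩, fun ⟨hk, hu⟩ => ⟨hk, fun n hn => ?_⟩⟩
  · obtain ⟨l, hl0, hl⟩ := exists_tendsto_resonanceMultiplier_ne_zero hk
    exact isUnit_of_tendsto_ne_zero
      (fun n => (resonanceMultiplier_ne_zero_iff n).2 (hk.2 _ (le_max_right n 2))) hl hl0
  · obtain ⟨g, hg⟩ := hu.exists_right_inv
    have hne : resonanceMultiplier β γ k n ≠ 0 :=
      left_ne_zero_of_mul_eq_one (DFunLike.congr_fun hg n)
    rwa [resonanceMultiplier_ne_zero_iff, max_eq_left hn] at hne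

lemma isOpen_nonresonantWavenumbers (β γ : ℝ) : IsOpen (nonresonantWavenumbers β γ) := by
  have hcont : Continuous (resonanceMultiplier β γ) := by
    unfold resonanceMultiplier
    fun_prop
  rw [show nonresonantWavenumbers β γ = _ from Set.ext fun k => mem_nonresonantWavenumbers_iff]
  exact isOpen_Ioi.inter (Units.isOpen.preimage hcont)

lemma stokesMultiplier_apply_of_lt (β γ k : ℝ) {n : ℕ} (hn : n < 2) :
    stokesMultiplier β γ k n = 0 := by
  change k ^ 2 * ((if 2 ≤ n then _ else 0) * _) = 0
  rw [if_neg hn.not_ge, zero_mul, mul_zero]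

section Nonresonant

variable {β γ k : ℝ} (hk : k ∈ nonresonantWavenumbers β γ)
include hk

lemma contDiffAt_stokesMultiplier : ContDiffAt ℝ ω (stokesMultiplier β γ) k := by
  have hres : ContDiff ℝ ω (resonanceMultiplier β γ) := by
    unfold resonanceMultiplier
    fun_prop
  obtain ⟨u, hu⟩ := (mem_nonresonantWavenumbers_iff.1 hk).2
  have hinv : ContDiffAt ℝ ω Ring.inverse (resonanceMultiplier β γ k) :=
    hu ▸ contDiffAt_ringInverse ℝ u
  exact (contDiffAt_id.pow 2).smul (contDiffAt_const.mul (hinv.comp k hres.contDiffAt))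

lemma stokesMultiplier_mul_resonanceMultiplier (n : ℕ) :
    stokesMultiplier β γ k n * resonanceMultiplier β γ k n = k ^ 2 * stokesWeight β n := by
  have h : stokesMultiplier β γ k * resonanceMultiplier β γ k = k ^ 2 • stokesWeight β := by
    rw [stokesMultiplier, smul_mul_assoc, mul_assoc,
      Ring.inverse_mul_cancel _ (mem_nonresonantWavenumbers_iff.1 hk).2, mul_one]
  exact DFunLike.congr_fun h n

lemma stokesMultiplier_mul {n : ℕ} (hn : 2 ≤ n) :
    stokesMultiplier β γ k n * ((n ^ 2 - 1) * (β * k ^ 4 * n ^ 2 - γ)) = k ^ 2 * n ^ 2 := by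
  have hn1 : (n : ℝ) ^ 2 - 1 ≠ 0 := by
    have : (2 : ℝ) ≤ n := by exact_mod_cast hn
    nlinarith
  have hweight : stokesWeight β n = (n : ℝ) ^ 2 / ((n ^ 2 - 1) * (|β| * n ^ 2 + 1)) := if_pos hn
  have h := stokesMultiplier_mul_resonanceMultiplier hk n
  have hden : |β| * (n : ℝ) ^ 2 + 1 ≠ 0 := by positivity
  rw [resonanceMultiplier_apply, max_eq_left hn, hweight] at h
  field_simp at h
  linear_combination h

end Nonresonant

end

/-! ### Reduction of the profile equation to a fixed-point equation -/

noncomputable section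

namespace CosineSpace

/-- The square of the rescaled profile `cos z + v`. -/
def profileSq (v : CosineSpace) : CosineSpace := prod (mode 1 + v) (mode 1 + v)

/-- The nonlinearity of the reduced equation `v = a m · nonlin v`, where `m = stokesMultiplier`. The
coefficient of `v` is the correction which the equation in the mode `cos z` forces on the speed. -/
def nonlin (v : CosineSpace) : CosineSpace := coeff 1 (profileSq v) • v - profileSq v

/-- The speed of the wave with amplitude `a` and profile `a (cos z + v)`. -/
def waveSpeed (β γ a k : ℝ) (v : CosineSpace) : ℝ := speed0 β γ k + a * coeff 1 (profileSq v)

lemma contDiff_profileSq : ContDiff ℝ ω profileSq := by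
  unfold profileSq
  fun_prop

lemma contDiff_nonlin : ContDiff ℝ ω nonlin :=
  (((coeff 1).contDiff.comp contDiff_profileSq).smul contDiff_id).sub contDiff_profileSq

lemma profileSq_neg_shift (v : CosineSpace) : profileSq (-shift v) = shift (profileSq v) := by
  have h : mode 1 + -shift v = -shift (mode 1 + v) := by simp [add_comm]
  simp only [profileSq, h, map_neg, neg_apply, neg_neg, prod_shift]

lemma nonlin_neg_shift (v : CosineSpace) : nonlin (-shift v) = shift (nonlin v) := by
  simp [nonlin, profileSq_neg_shift, coeff_shift]

lemma waveSpeed_neg_shift (β γ a k : ℝ) (v : CosineSpace) :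
    waveSpeed β γ (-a) k (-shift v) = waveSpeed β γ a k v := by
  simp [waveSpeed, profileSq_neg_shift, coeff_shift]

lemma profile_combination_eq_zero_of_coeff {p q r s z : ℝ} {x y : CosineSpace}
    (h : ∀ n : ℕ, (-p * n ^ 2 + q * n ^ 4 + s) * coeff n x + r * n ^ 2 * coeff n y = 0) :
    p * evalDeriv 2 z x + q * evalDeriv 4 z x - r * evalDeriv 2 z y + s * evalDeriv 0 z x = 0 := by
  have hsum := ((((hasSum_evalDeriv 2 z x).mul_left p).add
    ((hasSum_evalDeriv 4 z x).mul_left q)).sub ((hasSum_evalDeriv 2 z y).mul_left r)).add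
    ((hasSum_evalDeriv 0 z x).mul_left s)
  refine hsum.unique ?_
  convert! hasSum_zero using 1
  funext n
  have h2 : cos (n * z + (2 : ℕ) * (π / 2)) = -cos (n * z) := by
    rw [← cos_add_pi]; push_cast; ring_nf
  have h4 : cos (n * z + (4 : ℕ) * (π / 2)) = cos (n * z) := by
    rw [← cos_add_two_pi (n * z)]; push_cast; ring_nf
  have h0 : cos (n * z + (0 : ℕ) * (π / 2)) = cos (n * z) := by simp
  rw [h0, h2, h4]
  linear_combination cos (n * z) * h n

lemma coeff_profile_equation {β γ k a : ℝ} {v : CosineSpace} (hk : k ∈ nonresonantWavenumbers β γ)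
    (hv : v = diag (nonlin v) (a • stokesMultiplier β γ k)) (n : ℕ) :
    (-(waveSpeed β γ a k v * k ^ 2) * n ^ 2 + β * k ^ 4 * n ^ 4 + γ) * coeff n (mode 1 + v) +
      k ^ 2 * n ^ 2 * (a * coeff n (profileSq v)) = 0 := by
  have hvn : coeff n v = a * stokesMultiplier β γ k n *
      (coeff 1 (profileSq v) * coeff n v - coeff n (profileSq v)) := by
    conv_lhs => rw [hv, coeff_diag, nonlin, map_sub, map_smul]
    rfl
  have hspeed : waveSpeed β γ a k v * k ^ 2 =
      γ + β * k ^ 4 + k ^ 2 * a * coeff 1 (profileSq v) := by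
    have := hk.1.ne'
    rw [waveSpeed, speed0]
    field_simp
  have hlow (hn : n < 2) : coeff n v = 0 := by
    rw [hvn, stokesMultiplier_apply_of_lt β γ k hn]
    ring
  rw [map_add, coeff_mode, hspeed]
  obtain rfl | rfl | hn : n = 0 ∨ n = 1 ∨ 2 ≤ n := by omega
  · simp [hlow]
  · simp only [Nat.cast_one, one_pow, mul_one, if_true, hlow one_lt_two, add_zero]
    ring
  · rw [if_neg (by omega), zero_add]
    linear_combination ((n : ℝ) ^ 2 - 1) * (β * k ^ 4 * n ^ 2 - γ) * hvn +
      a * (coeff 1 (profileSq v) * coeff n v - coeff n (profileSq v)) * stokesMultiplier_mul hk hn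

lemma solvesProfile_of_fixedPoint {β γ k a : ℝ} {v : CosineSpace}
    (hk : k ∈ nonresonantWavenumbers β γ)
    (hv : v = diag (nonlin v) (a • stokesMultiplier β γ k)) :
    SolvesProfile β γ k (waveSpeed β γ a k v) (fun z => evalDeriv 0 z (a • (mode 1 + v))) := by
  intro z
  have hsq : (fun y => evalDeriv 0 y (a • (mode 1 + v)) ^ 2) =
      fun y => evalDeriv 0 y (a ^ 2 • profileSq v) := by
    funext y
    rw [map_smul, map_smul, profileSq, evalDeriv_zero_prod]
    simp only [smul_eq_mul]
    ring
  simp only [hsq, iteratedDeriv_evalDeriv]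
  refine profile_combination_eq_zero_of_coeff fun n => ?_
  simp only [map_smul, smul_eq_mul]
  linear_combination a * coeff_profile_equation hk hv n

end CosineSpace

end

/-! ### The Stokes expansion -/

noncomputable section

section Coefficients

variable {β γ k : ℝ} (hk : k ∈ nonresonantWavenumbers β γ)
include hk

lemma coeffA2_eq_stokesMultiplier : coeffA2 β γ k = -(stokesMultiplier β γ k 2 / 2) := by
  have hm := stokesMultiplier_mul hk le_rfl
  have hres := hk.2 2 le_rfl
  push_cast at hm hres
  have hden : 3 * γ - 12 * β * k ^ 4 ≠ 0 := fun h => hres (by linarith)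
  rw [coeffA2, div_eq_iff hden]
  linear_combination -hm / 2

lemma coeffA3_eq_stokesMultiplier :
    coeffA3 β γ k = -(stokesMultiplier β γ k 3 * coeffA2 β γ k) := by
  have hm := stokesMultiplier_mul hk (show 2 ≤ 3 by norm_num)
  have hres := hk.2 3 (by norm_num)
  push_cast at hm hres
  have hden : 8 * γ - 72 * β * k ^ 4 ≠ 0 := fun h => hres (by linarith)
  rw [coeffA3, div_eq_iff hden]
  linear_combination -coeffA2 β γ k * hm

lemma coeffA42_eq_stokesMultiplier :
    coeffA42 β γ k = stokesMultiplier β γ k 2 * (coeffA2 β γ k ^ 2 - coeffA3 β γ k) := by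
  rw [coeffA42]
  linear_combination
    (2 * coeffA3 β γ k - 2 * coeffA2 β γ k ^ 2) * coeffA2_eq_stokesMultiplier hk

lemma coeffA44_eq_stokesMultiplier :
    coeffA44 β γ k =
      -(stokesMultiplier β γ k 4 * (coeffA2 β γ k ^ 2 / 2 + coeffA3 β γ k)) := by
  have hm := stokesMultiplier_mul hk (show 2 ≤ 4 by norm_num)
  have hres := hk.2 4 (by norm_num)
  push_cast at hm hres
  have hden : 15 * γ - 240 * β * k ^ 4 ≠ 0 := fun h => hres (by linarith)
  rw [coeffA44, div_eq_iff hden]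
  linear_combination -(coeffA2 β γ k ^ 2 / 2 + coeffA3 β γ k) * hm

end Coefficients

namespace CosineSpace

/-- The fourth-order Stokes expansion of the reduced profile `v`, where `w = a (cos z + v)`. -/
def stokesApprox (β γ k a : ℝ) : CosineSpace :=
  (a * coeffA2 β γ k + a ^ 3 * coeffA42 β γ k) • mode 2 + (a ^ 2 * coeffA3 β γ k) • mode 3 +
    (a ^ 3 * coeffA44 β γ k) • mode 4

lemma continuous_stokesApprox (β γ k : ℝ) : Continuous (stokesApprox β γ k) := by
  unfold stokesApprox
  fun_prop

lemma tendsto_stokesApprox (β γ k : ℝ) : Tendsto (stokesApprox β γ k) (𝓝 0) (𝓝 0) := by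
  simpa [stokesApprox] using (continuous_stokesApprox β γ k).tendsto 0

lemma evalDeriv_stokesApprox (β γ k a z : ℝ) :
    evalDeriv 0 z (a • (mode 1 + stokesApprox β γ k a)) = profileExpansion β γ k a z := by
  simp only [stokesApprox, profileExpansion, smul_add, map_add, map_smul, evalDeriv_mode, pow_zero,
    one_mul, Nat.cast_zero, Nat.cast_one, Nat.cast_ofNat, zero_mul, add_zero, smul_eq_mul]
  ring

lemma profileSq_modes (p q r : ℝ) :
    profileSq (p • mode 2 + q • mode 3 + r • mode 4) =
      ((1 + p ^ 2 + q ^ 2 + r ^ 2) / 2) • mode 0 + (p + p * q + q * r) • mode 1 +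
      (1 / 2 + q + p * r) • mode 2 + (p + r) • mode 3 + (p ^ 2 / 2 + q) • mode 4 +
      (r + p * q) • mode 5 + (p * r + q ^ 2 / 2) • mode 6 + (q * r) • mode 7 +
      (r ^ 2 / 2) • mode 8 := by
  simp only [profileSq, map_add, map_smul, add_apply, smul_apply, prod_mode]
  norm_num
  module

lemma coeff_one_profileSq_modes (p q r : ℝ) :
    coeff 1 (profileSq (p • mode 2 + q • mode 3 + r • mode 4)) = p + p * q + q * r := by
  simp [profileSq_modes, coeff_mode]

lemma exists_stokesApprox_eq_add {β γ k : ℝ} (hk : k ∈ nonresonantWavenumbers β γ) :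
    ∃ r : ℝ → CosineSpace, Continuous r ∧ ∀ a,
      stokesApprox β γ k a = diag (nonlin (stokesApprox β γ k a)) (a • stokesMultiplier β γ k) +
        a ^ 4 • r a := by
  have hm0 := stokesMultiplier_apply_of_lt β γ k (n := 0) (by norm_num)
  have hm1 := stokesMultiplier_apply_of_lt β γ k (n := 1) (by norm_num)
  have hA := coeffA2_eq_stokesMultiplier hk
  have hB := coeffA3_eq_stokesMultiplier hk
  have hC := coeffA42_eq_stokesMultiplier hk
  have hD := coeffA44_eq_stokesMultiplier hk
  simp only [stokesApprox, nonlin, coeff_one_profileSq_modes]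
  simp only [profileSq_modes]
  generalize coeffA2 β γ k = A at *
  generalize coeffA3 β γ k = B at *
  generalize coeffA42 β γ k = C at *
  generalize coeffA44 β γ k = D at *
  generalize stokesMultiplier β γ k = m at *
  -- Read off by expanding in powers of `a`: the speed correction is `a A + a ^ 3 E`.
  let E (a : ℝ) : ℝ := C + (A + a ^ 2 * C) * B + a ^ 2 * B * D
  refine ⟨fun a =>
    (a * m 2 * ((A + a ^ 2 * C) * D - E a * (A + a ^ 2 * C) - A * C)) • mode 2 +
    (m 3 * (C + D - (A + a ^ 2 * E a) * B)) • mode 3 +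
    (a * m 4 * (-((A + a ^ 2 * E a) * D) + A * C + a ^ 2 * C ^ 2 / 2)) • mode 4 +
    (m 5 * (D + (A + a ^ 2 * C) * B)) • mode 5 +
    (a * m 6 * ((A + a ^ 2 * C) * D + B ^ 2 / 2)) • mode 6 +
    (a ^ 2 * m 7 * (B * D)) • mode 7 + (a ^ 3 * m 8 * (D ^ 2 / 2)) • mode 8, by fun_prop,
    fun a => ?_⟩
  simp only [map_add, map_sub, map_smul, add_apply, sub_apply, smul_apply, diag_mode, hm0, hm1, E]
  match_scalars
  · linear_combination a * hA + a ^ 3 * hC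
  · linear_combination a ^ 2 * hB
  · linear_combination a ^ 3 * hD
  all_goals ring

section Branch

variable {β γ k : ℝ} {V : ℝ → CosineSpace} (hV : Tendsto V (𝓝 0) (𝓝 0))
include hV

lemma isBigO_comp_sub_comp_stokesApprox {E : Type*} [NormedAddCommGroup E] [NormedSpace ℝ E]
    {f : CosineSpace → E} (hf : ContDiff ℝ ω f) :
    (fun a => f (V a) - f (stokesApprox β γ k a)) =O[𝓝 0] fun a => V a - stokesApprox β γ k a :=
  (hf.contDiffAt.hasStrictFDerivAt (by simp)).isBigO_sub.comp_tendsto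
    (hV.prodMk_nhds (tendsto_stokesApprox β γ k))

lemma isBigO_sub_stokesApprox (hk : k ∈ nonresonantWavenumbers β γ)
    (hfix : ∀ᶠ a in 𝓝 0, V a = diag (nonlin (V a)) (a • stokesMultiplier β γ k)) :
    (fun a => V a - stokesApprox β γ k a) =O[𝓝 0] fun a : ℝ => a ^ 4 := by
  obtain ⟨r, hr, hres⟩ := exists_stokesApprox_eq_add hk
  set m := stokesMultiplier β γ k
  have hdiff : (fun a => V a - stokesApprox β γ k a) =ᶠ[𝓝 0] fun a =>
      diag.flip m (a • (nonlin (V a) - nonlin (stokesApprox β γ k a))) - a ^ 4 • r a := by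
    filter_upwards [hfix] with a ha
    nth_rewrite 1 [ha, hres a]
    simp only [map_smul, map_sub, ContinuousLinearMap.flip_apply, smul_sub]
    abel
  -- Thanks to the factor `a`, the Lipschitz term is absorbed by the left-hand side of `hdiff`.
  have hsmall : (fun a => diag.flip m (a • (nonlin (V a) - nonlin (stokesApprox β γ k a))))
      =o[𝓝 0] fun a => V a - stokesApprox β γ k a := by
    refine ((diag.flip m).isBigO_comp _ _).trans_isLittleO ?_
    simpa using ((isLittleO_one_iff ℝ).2 (tendsto_id (α := ℝ) (x := 𝓝 0))).smul_isBigO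
      (isBigO_comp_sub_comp_stokesApprox (β := β) (γ := γ) (k := k) hV contDiff_nonlin)
  have hr4 : (fun a => a ^ 4 • r a) =O[𝓝 0] fun a : ℝ => a ^ 4 := by
    simpa using (isBigO_refl (fun a : ℝ => a ^ 4) (𝓝 0)).smul ((hr.tendsto 0).isBigO_one ℝ)
  have hclose : (fun a => V a - stokesApprox β γ k a) =O[𝓝 0] fun a => a ^ 4 • r a := by
    refine hsmall.right_isBigO_sub.trans (IsBigO.of_bound 1 ?_)
    filter_upwards [hdiff] with a ha
    rw [one_mul, ha]
    simp
  exact hclose.trans hr4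

lemma isBigO_waveSpeed_sub_speedExpansion
    (hO : (fun a => V a - stokesApprox β γ k a) =O[𝓝 0] fun a : ℝ => a ^ 4) :
    (fun a => waveSpeed β γ a k (V a) - speedExpansion β γ k a) =O[𝓝 0] fun a : ℝ => a ^ 5 := by
  have hcoeff := (isBigO_comp_sub_comp_stokesApprox (β := β) (γ := γ) (k := k) hV
    ((coeff 1).contDiff.comp contDiff_profileSq)).trans hO
  have hspeed := (isBigO_refl (fun a : ℝ => a) (𝓝 0)).mul hcoeff
  have htail := (isBigO_const_mul_self
    (coeffA42 β γ k * coeffA3 β γ k + coeffA3 β γ k * coeffA44 β γ k) (fun a : ℝ => a ^ 6)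
    (𝓝 0)).trans (isLittleO_pow_pow (show 5 < 6 by norm_num)).isBigO
  simp only [← pow_succ'] at hspeed
  refine (hspeed.add htail).congr_left fun a => ?_
  simp only [Function.comp_apply, waveSpeed, speedExpansion, speed2, speed4, stokesApprox,
    coeff_one_profileSq_modes, coeffA42]
  ring

end Branch

end CosineSpace

end

/-! ### The bifurcating branch -/

noncomputable section

namespace CosineSpace

lemma exists_analyticAt_diag_nonlin_fixedPoint :
    ∃ Φ : Multiplier → CosineSpace, Φ 0 = 0 ∧ ∀ᶠ μ in 𝓝 0,
      AnalyticAt ℝ Φ μ ∧ Φ μ = diag (nonlin (Φ μ)) μ ∧ Φ (-μ) = -shift (Φ μ) := by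
  obtain ⟨Φ, hΦ0, hΦ, hiff⟩ := exists_analyticAt_fixedPoint diag contDiff_nonlin.contDiffAt
  have hcont : Tendsto Φ (𝓝 0) (𝓝 0) := by simpa only [hΦ0] using hΦ.continuousAt.tendsto
  have hgraph : Tendsto (fun μ => (μ, Φ μ)) (𝓝 0) (𝓝 0) := tendsto_id.prodMk_nhds hcont
  have hreflect : Tendsto (fun μ => (-μ, -shift (Φ μ))) (𝓝 0) (𝓝 0) := by
    have hneg : Tendsto (fun μ : Multiplier => -μ) (𝓝 0) (𝓝 0) := by
      simpa using (tendsto_id (α := Multiplier) (x := 𝓝 0)).neg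
    have hshift : Tendsto (fun μ => -shift (Φ μ)) (𝓝 0) (𝓝 0) := by
      simpa using ((shift.continuous.tendsto' 0 0 (map_zero _)).comp hcont).neg
    exact hneg.prodMk_nhds hshift
  refine ⟨Φ, hΦ0, ?_⟩
  filter_upwards [hΦ.eventually_analyticAt, hgraph.eventually hiff, hreflect.eventually hiff]
    with μ hμ hfix huniq
  have hfixμ := hfix.2 rfl
  refine ⟨hμ, hfixμ, huniq.1 ?_⟩
  simp only [nonlin_neg_shift, diag_shift, map_neg, ← hfixμ]

end CosineSpace

open CosineSpace

/-- A symmetric analytic branch of solutions `V a k` of the reduced equation, over an open set `Ω`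
of nonresonant pairs `(a, k)` and starting from the trivial solution at `a = 0`. The waves of the
branch are `a (cos z + V a k)`. -/
structure IsStokesBranch (β γ : ℝ) (Ω : Set (ℝ × ℝ)) (V : ℝ → ℝ → CosineSpace) : Prop where
  isOpen : IsOpen Ω
  zero_mem : ∀ k ∈ nonresonantWavenumbers β γ, (0, k) ∈ Ω
  nonresonant : ∀ a k, (a, k) ∈ Ω → k ∈ nonresonantWavenumbers β γ
  neg_mem : ∀ a k, (a, k) ∈ Ω → (-a, k) ∈ Ω
  apply_zero : ∀ k, V 0 k = 0
  analyticOnNhd : AnalyticOnNhd ℝ (fun p : ℝ × ℝ => V p.1 p.2) Ω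
  fixedPoint : ∀ a k, (a, k) ∈ Ω → V a k = diag (nonlin (V a k)) (a • stokesMultiplier β γ k)
  apply_neg : ∀ a k, (a, k) ∈ Ω → V (-a) k = -shift (V a k)

lemma contDiffAt_smul_stokesMultiplier {β γ : ℝ} {p : ℝ × ℝ}
    (hp : p.2 ∈ nonresonantWavenumbers β γ) :
    ContDiffAt ℝ ω (fun p : ℝ × ℝ => p.1 • stokesMultiplier β γ p.2) p :=
  contDiffAt_fst.smul ((contDiffAt_stokesMultiplier hp).comp p contDiffAt_snd)

lemma isOpen_nonresonant_inter_norm_lt (β γ ε : ℝ) :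
    IsOpen {p : ℝ × ℝ | p.2 ∈ nonresonantWavenumbers β γ ∧
      ‖p.1 • stokesMultiplier β γ p.2‖ < ε} :=
  ContinuousOn.isOpen_inter_preimage (t := Set.Iio ε)
    (fun _ hp => (contDiffAt_smul_stokesMultiplier hp).continuousAt.continuousWithinAt.norm)
    ((isOpen_nonresonantWavenumbers β γ).preimage continuous_snd) isOpen_Iio

theorem exists_isStokesBranch (β γ : ℝ) : ∃ Ω V, IsStokesBranch β γ Ω V := by
  obtain ⟨Φ, hΦ0, hΦ⟩ := exists_analyticAt_diag_nonlin_fixedPoint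
  obtain ⟨ε, hε, hball⟩ := Metric.eventually_nhds_iff_ball.1 hΦ
  simp only [mem_ball_zero_iff] at hball
  have hneg (a k : ℝ) : -a • stokesMultiplier β γ k = -(a • stokesMultiplier β γ k) :=
    neg_smul a (stokesMultiplier β γ k)
  exact ⟨{p | p.2 ∈ nonresonantWavenumbers β γ ∧ ‖p.1 • stokesMultiplier β γ p.2‖ < ε},
    fun a k => Φ (a • stokesMultiplier β γ k),
    { isOpen := isOpen_nonresonant_inter_norm_lt β γ ε
      zero_mem := fun k hk => ⟨hk, by simpa using hε⟩
      nonresonant := fun _ _ hp => hp.1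
      neg_mem := fun a k hp => ⟨hp.1, by simpa only [hneg, norm_neg] using hp.2⟩
      apply_zero := fun k => by rw [zero_smul, hΦ0]
      analyticOnNhd := fun p hp =>
        AnalyticAt.fun_comp (g := Φ) (hball _ hp.2).1
          (contDiffAt_smul_stokesMultiplier hp.1).analyticAt
      fixedPoint := fun a k hp => (hball _ hp.2).2.1
      apply_neg := fun a k hp => by rw [hneg, (hball _ hp.2).2.2] }⟩

namespace IsStokesBranch

variable {β γ a k : ℝ} {Ω : Set (ℝ × ℝ)} {V : ℝ → ℝ → CosineSpace}

lemma solvesProfile (h : IsStokesBranch β γ Ω V) (hp : (a, k) ∈ Ω) :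
    SolvesProfile β γ k (waveSpeed β γ a k (V a k))
      (fun z => evalDeriv 0 z (a • (mode 1 + V a k))) :=
  solvesProfile_of_fixedPoint (h.nonresonant a k hp) (h.fixedPoint a k hp)

lemma waveSpeed_neg (h : IsStokesBranch β γ Ω V) (hp : (a, k) ∈ Ω) :
    waveSpeed β γ (-a) k (V (-a) k) = waveSpeed β γ a k (V a k) := by
  rw [h.apply_neg a k hp, waveSpeed_neg_shift]

lemma analyticOnNhd_waveSpeed (h : IsStokesBranch β γ Ω V) :
    AnalyticOnNhd ℝ (fun p : ℝ × ℝ => waveSpeed β γ p.1 p.2 (V p.1 p.2)) Ω := fun p hp => by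
  have hk : p.2 ^ 2 ≠ 0 := pow_ne_zero 2 (h.nonresonant p.1 p.2 hp).1.ne'
  have hspeed0 : AnalyticAt ℝ (fun p : ℝ × ℝ => speed0 β γ p.2) p :=
    (analyticAt_const.div (analyticAt_snd.pow 2) hk).add
      (analyticAt_const.mul (analyticAt_snd.pow 2))
  have hcoeff : AnalyticAt ℝ (fun p : ℝ × ℝ => coeff 1 (profileSq (V p.1 p.2))) p :=
    ((coeff 1).contDiff.comp contDiff_profileSq).contDiffAt.analyticAt.fun_comp
      (h.analyticOnNhd p hp)
  exact hspeed0.add (analyticAt_fst.mul hcoeff)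

lemma analyticProfileFamilyOn (h : IsStokesBranch β γ Ω V) :
    AnalyticProfileFamilyOn (fun a k z => evalDeriv 0 z (a • (mode 1 + V a k))) Ω := fun j => by
  have hprofile : AnalyticOnNhd ℝ (fun p : ℝ × ℝ => p.1 • (mode 1 + V p.1 p.2)) Ω :=
    analyticOnNhd_fst.smul (analyticOnNhd_const.add h.analyticOnNhd)
  obtain ⟨D, hD, hDeq⟩ := exists_analyticOnNhd_circle_iteratedDeriv_eq hprofile j
  exact ⟨D, hD, fun p _ => hDeq p⟩

section Expansion

variable (h : IsStokesBranch β γ Ω V) (hk : k ∈ nonresonantWavenumbers β γ)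
include h hk

lemma analyticAt_zero : AnalyticAt ℝ (fun a => V a k) 0 :=
  (h.analyticOnNhd _ (h.zero_mem k hk)).fun_comp (f := fun a : ℝ => (a, k)) (by fun_prop)

lemma tendsto_zero : Tendsto (fun a => V a k) (𝓝 0) (𝓝 0) := by
  simpa only [h.apply_zero] using (h.analyticAt_zero hk).continuousAt.tendsto

lemma eventually_mem : ∀ᶠ a in 𝓝 (0 : ℝ), (a, k) ∈ Ω :=
  (Continuous.prodMk_left k).continuousAt.eventually_mem (h.isOpen.mem_nhds (h.zero_mem k hk))

lemma isBigO_sub_stokesApprox :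
    (fun a => V a k - stokesApprox β γ k a) =O[𝓝 0] fun a : ℝ => a ^ 4 :=
  CosineSpace.isBigO_sub_stokesApprox (h.tendsto_zero hk) hk
    ((h.eventually_mem hk).mono fun a => h.fixedPoint a k)

lemma exists_abs_iteratedDeriv_sub_profileExpansion_le (j : ℕ) :
    ∃ C : ℝ, ∀ᶠ a in 𝓝 (0 : ℝ), ∀ z : ℝ,
      |iteratedDeriv j (fun y => evalDeriv 0 y (a • (mode 1 + V a k)) -
        profileExpansion β γ k a y) z| ≤ C * |a| ^ 5 := by
  obtain ⟨C, hC⟩ := (h.isBigO_sub_stokesApprox hk).bound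
  refine ⟨j.factorial * C, hC.mono fun a ha z => ?_⟩
  simp only [← evalDeriv_stokesApprox, ← map_sub, ← smul_sub, add_sub_add_left_eq_sub,
    iteratedDeriv_evalDeriv]
  rw [norm_pow, norm_eq_abs a] at ha
  calc |evalDeriv j z (a • (V a k - stokesApprox β γ k a))|
      ≤ j.factorial * (|a| * ‖V a k - stokesApprox β γ k a‖) :=
        (abs_evalDeriv_le j z _).trans_eq (by rw [norm_smul, norm_eq_abs])
    _ ≤ j.factorial * (|a| * (C * |a| ^ 4)) := by gcongr
    _ = j.factorial * C * |a| ^ 5 := by ring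

lemma isBigO_waveSpeed_sub_speedExpansion :
    (fun a => waveSpeed β γ a k (V a k) - speedExpansion β γ k a) =O[𝓝 0] fun a : ℝ => a ^ 6 := by
  have hspeed : AnalyticAt ℝ (fun a => waveSpeed β γ a k (V a k)) 0 :=
    (h.analyticOnNhd_waveSpeed _ (h.zero_mem k hk)).fun_comp (f := fun a : ℝ => (a, k))
      (by fun_prop)
  have hexp : AnalyticAt ℝ (speedExpansion β γ k) 0 := by
    unfold speedExpansion
    fun_prop
  refine isBigO_pow_succ_of_even (hspeed.sub hexp) ?_ (by decide)
    (CosineSpace.isBigO_waveSpeed_sub_speedExpansion (h.tendsto_zero hk)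
      (h.isBigO_sub_stokesApprox hk))
  filter_upwards [h.eventually_mem hk] with a ha
  simp only [Pi.sub_apply, h.waveSpeed_neg ha, speedExpansion, even_two.neg_pow,
    (by decide : Even 4).neg_pow]

end Expansion

end IsStokesBranch

end

open CosineSpace in
theorem theorem2p1_general (β γ : ℝ) :
    ∃ (Ω : Set (ℝ × ℝ)) (w : ℝ → ℝ → ℝ → ℝ) (c : ℝ → ℝ → ℝ),
      IsOpen Ω ∧
      (∀ k ∈ nonresonantWavenumbers β γ, ((0 : ℝ), k) ∈ Ω) ∧
      (∀ a k : ℝ, (a, k) ∈ Ω → k ∈ nonresonantWavenumbers β γ ∧ (-a, k) ∈ Ω) ∧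
      (∀ a k : ℝ, (a, k) ∈ Ω →
        ContDiff ℝ ∞ (w a k) ∧
        Function.Periodic (w a k) (2 * π) ∧
        Function.Even (w a k) ∧
        SolvesProfile β γ k (c a k) (w a k) ∧
        SolvesOstrovsky β γ (fun x t : ℝ => w a k (k * (x - c a k * t))) ∧
        c (-a) k = c a k) ∧
      (∀ k ∈ nonresonantWavenumbers β γ, (∀ z : ℝ, w 0 k z = 0) ∧ c 0 k = speed0 β γ k) ∧
      AnalyticProfileFamilyOn w Ω ∧
      AnalyticOnNhd ℝ (fun p : ℝ × ℝ => c p.1 p.2) Ω ∧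
      (∀ k ∈ nonresonantWavenumbers β γ,
        (∀ j : ℕ, ∃ C : ℝ, ∀ᶠ a in 𝓝 (0 : ℝ), ∀ z : ℝ,
          |iteratedDeriv j (fun y : ℝ => w a k y - profileExpansion β γ k a y) z| ≤ C * |a| ^ 5) ∧
        (fun a : ℝ => c a k - speedExpansion β γ k a) =O[𝓝 0] (fun a : ℝ => a ^ 6)) := by
  obtain ⟨Ω, V, h⟩ := exists_isStokesBranch β γ
  refine ⟨Ω, fun a k z => evalDeriv 0 z (a • (mode 1 + V a k)),
    fun a k => waveSpeed β γ a k (V a k), h.isOpen, h.zero_mem,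
    fun a k hp => ⟨h.nonresonant a k hp, h.neg_mem a k hp⟩, fun a k hp => ?_, fun k _ => ?_,
    h.analyticProfileFamilyOn, h.analyticOnNhd_waveSpeed, fun k hk =>
      ⟨h.exists_abs_iteratedDeriv_sub_profileExpansion_le hk,
        h.isBigO_waveSpeed_sub_speedExpansion hk⟩⟩
  · have hsmooth := contDiff_evalDeriv (a • (mode 1 + V a k))
    exact ⟨hsmooth, periodic_evalDeriv 0 _, even_evalDeriv_zero _, h.solvesProfile hp,
      (h.solvesProfile hp).solvesOstrovsky (contDiff_infty.1 hsmooth 4),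
      h.waveSpeed_neg hp⟩
  · exact ⟨fun z => by simp, by simp [waveSpeed]⟩

theorem theorem2p1 (β γ : ℝ) (hγ : 0 < γ) (hβ : β ≠ 0) :
    ∃ (Ω : Set (ℝ × ℝ)) (w : ℝ → ℝ → ℝ → ℝ) (c : ℝ → ℝ → ℝ),
      -- the parameter domain: an open neighbourhood of `{0} × K`, symmetric in `a`,
      -- where `K` is the set of admissible wavenumbers
      IsOpen Ω ∧
      (∀ k ∈ admissibleWavenumbers β γ, ((0 : ℝ), k) ∈ Ω) ∧
      (∀ a k : ℝ, (a, k) ∈ Ω → k ∈ admissibleWavenumbers β γ ∧ (-a, k) ∈ Ω) ∧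
      -- the solutions
      (∀ a k : ℝ, (a, k) ∈ Ω →
        ContDiff ℝ ∞ (w a k) ∧
        Function.Periodic (w a k) (2 * π) ∧
        Function.Even (w a k) ∧
        SolvesProfile β γ k (c a k) (w a k) ∧
        SolvesOstrovsky β γ (fun x t : ℝ => w a k (k * (x - c a k * t))) ∧
        c (-a) k = c a k) ∧
      -- bifurcation from the zero solution at the speed `c₀`
      (∀ k ∈ admissibleWavenumbers β γ, (∀ z : ℝ, w 0 k z = 0) ∧ c 0 k = speed0 β γ k) ∧
      -- joint analyticity in `(a, k)`
      AnalyticProfileFamilyOn w Ω ∧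
      AnalyticOnNhd ℝ (fun p : ℝ × ℝ => c p.1 p.2) Ω ∧
      -- expansions as `a → 0`; that of `w` is uniform in `z`, together with all `z`-derivatives
      (∀ k ∈ admissibleWavenumbers β γ,
        (∀ j : ℕ, ∃ C : ℝ, ∀ᶠ a in 𝓝 (0 : ℝ), ∀ z : ℝ,
          |iteratedDeriv j (fun y : ℝ => w a k y - profileExpansion β γ k a y) z| ≤ C * |a| ^ 5) ∧
        (fun a : ℝ => c a k - speedExpansion β γ k a) =O[𝓝 0] (fun a : ℝ => a ^ 6)) := by
  rw [admissibleWavenumbers_eq_nonresonantWavenumbers hγ]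
  exact theorem2p1_general β γ
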